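/- Let $\beta_1<\beta_2$ be real numbers. A tropical plan of size $n\ge 1$ (between two max-plus probability measures with $n$ points each, all of whose weights are zero) is an $n\times n$ matrix $h=[h_{i,j}]$ with entries in $[-\infty,0]$ such that the maximum of every row and of every column is $0$. For a real cost matrix $c=[c_{i,j}]_{i,j=1}^n$, a tropical plan $h$ is optimal if it minimizes $\max_{i,j}(c_{i,j}+h_{i,j})$ among all tropical plans of size $n$; the set of optimal plans is denoted $\Pi^{c}$. The support of $h$ is the set of pairs $(i,j)$ with $h_{i,j}>-\infty$. A perfect matching plan is a tropical plan whose support is $\{(i,\sigma(i)) : 1\le i\le n\}$ for some permutation $\sigma$ of $\{1,\dots,n\}$. A tropical plan $h$ contains a perfect matching if there is a perfect matching plan $\tilde h$ that arises from $h$ by replacing some of the zero entries of $h$ by $-\infty$ (in particular, the support of $\tilde h$ is contained in that of $h$). For each $n\ge 1$ let $c^n$ be a random $n\times n$ matrix with independent entries satisfying $\mathbb P(c^n_{i,j}=\beta_1)=p_n$ and $\mathbb P(c^n_{i,j}=\beta_2)=1-p_n$ for all $i,j$. If $p_n\ge (\log n)/n$ for all but finitely many $n$, then $$\lim_{n\to\infty}\mathbb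 P\bigl(\exists\, h\in\Pi^{c^n}:\ h\text{ contains a perfect matching}\bigr)=1 .$$ -/

import Mathlib

open MeasureTheory ProbabilityTheory Filter Topology

namespace TropicalTransport

/-- Discrete max-plus measures on finite sets are identified with their families of weights
`k : ι → EReal`; transport plans are identified with matrices.  A tropical (max-plus) plan
for the weights `k` and `l` is a matrix with entries in `[-∞, 0]` whose `i`-th row has
maximum `k i` and whose `j`-th column has maximum `l j`. -/
structure IsPlan {ι κ : Type*} (k : ι → EReal) (l : κ → EReal) (h : ι → κ → EReal) : Prop where
  nonpos : ∀ i j, h i j ≤ 0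
  row_max : ∀ i, (⨆ j, h i j) = k i
  col_max : ∀ j, (⨆ i, h i j) = l j

/-- The tropical cost `max_{i,j} (c i j + h i j)` of a plan `h`. -/
noncomputable def planCost {ι κ : Type*} (c : ι → κ → ℝ) (h : ι → κ → EReal) : EReal :=
  ⨆ i, ⨆ j, ((c i j : EReal) + h i j)

/-- The optimal tropical cost `d_c`, the infimum of the cost over all plans. -/
noncomputable def optimalCost {ι κ : Type*} (c : ι → κ → ℝ) (k : ι → EReal) (l : κ → EReal) :
    EReal :=
  sInf {t | ∃ h : ι → κ → EReal, IsPlan k l h ∧ planCost c h = t}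

/-- Optimal (minimizing) tropical plans: plans at which the infimum is attained. -/
def IsOptimalPlan {ι κ : Type*} (c : ι → κ → ℝ) (k : ι → EReal) (l : κ → EReal)
    (h : ι → κ → EReal) : Prop :=
  IsPlan k l h ∧ planCost c h = optimalCost c k l

/-- The support of a plan: the positions of the entries different from `-∞`. -/
def planSupport {ι κ : Type*} (h : ι → κ → EReal) : Set (ι × κ) :=
  {q | h q.1 q.2 ≠ ⊥}

/-- A perfect matching plan: a plan supported on the graph of a permutation. -/
def IsPerfectMatchingPlan {n : ℕ} (k l : Fin n → EReal) (h : Fin n → Fin n → EReal) : Prop :=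
  IsPlan k l h ∧ ∃ σ : Equiv.Perm (Fin n), planSupport h = {q | q.2 = σ q.1}

/-- For a plan `h` of an `n × n` square all of whose row and column weights are `lam`:
`h` contains a perfect matching if there is a perfect matching plan for the same square, with
support contained in that of `h`, which arises from `h` by replacing some of
the entries of `h` that are equal to `lam` by `-∞`.  (For plans with entries in `{-∞, lam}` the
last condition follows from the inclusion of supports; for other plans it excludes
matchings through entries of `h` that are finite but smaller than `lam`.) -/
def ContainsPerfectMatching {n : ℕ} (lam : EReal) (h : Fin n → Fin n → EReal) : Prop :=
  ∃ h' : Fin n → Fin n → EReal,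
    IsPerfectMatchingPlan (fun _ => lam) (fun _ => lam) h' ∧
    planSupport h' ⊆ planSupport h ∧
    ∀ i j, h' i j = h i j ∨ (h i j = lam ∧ h' i j = ⊥)

/-- The weights of the `n`-point max-plus probability measure all of whose weights are zero. -/
noncomputable def zeroWeights (n : ℕ) : Fin n → EReal := fun _ => 0

/-- An `n × n` random matrix with independent entries, each of which takes the value `β₁` with
probability `p` and the value `β₂` with probability `1 - p`. -/
structure IsBernoulliCostMatrix {Ω : Type*} [MeasurableSpace Ω] (P : Measure Ω) {n : ℕ}
    (β₁ β₂ p : ℝ) (c : Ω → Fin n → Fin n → ℝ) : Prop where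
  measurable_entry : ∀ i j, Measurable fun ω => c ω i j
  indep : iIndepFun (fun (q : Fin n × Fin n) ω => c ω q.1 q.2) P
  prob_left : ∀ i j, P.real {ω | c ω i j = β₁} = p
  prob_right : ∀ i j, P.real {ω | c ω i j = β₂} = 1 - p

end TropicalTransport

/-! Isolated vertices, the usual obstruction to a matching near p = (log n)/n, are harmless here. If
some row or column has no entry `β₁`, every plan has a zero entry there and costs at least `β₂`, so
every permutation plan is optimal. If the `β₁` entries contain a perfect matching, its plan is
optimal with cost `β₁`. The only bad case (`exists_optimal_or`) is a bipartite graph without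
isolated vertices and without a perfect matching.

In that case a smallest Hall violator, taken over rows and columns together, gives sets S, T with
|S| = m + 1, |T| = m, 1 ≤ m, 2m + 1 ≤ n, no edge from S to the complement of T, and two edges into S
at each vertex of T (`exists_isHallObstruction`). A first-moment bound (`choose_mul_choose_mul_le`)
with x = np gives at most e² qᵐ expected obstructions of size m, where q = e² x² exp(-x/4). Since x
≥ log n → ∞, q → 0, and the geometric series over m ≥ 1 vanishes in the limit. -/

namespace TropicalTransport

/-! ### Permutation plans and the deterministic reduction -/

/-- The plan with entries `0` on the graph of a permutation and `-∞` elsewhere. -/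
noncomputable def permPlan {n : ℕ} (σ : Equiv.Perm (Fin n)) : Fin n → Fin n → EReal :=
  fun i j => if j = σ i then 0 else ⊥

theorem isPlan_permPlan {n : ℕ} (σ : Equiv.Perm (Fin n)) :
    IsPlan (zeroWeights n) (zeroWeights n) (permPlan σ) where
  nonpos i j := by unfold permPlan; split_ifs <;> simp
  row_max i := by
    refine le_antisymm (iSup_le fun j => ?_) (le_iSup_of_le (σ i) ?_)
    · unfold permPlan zeroWeights; split_ifs <;> simp
    · simp [permPlan, zeroWeights]
  col_max j := by
    refine le_antisymm (iSup_le fun i => ?_) (le_iSup_of_le (σ.symm j) ?_)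
    · unfold permPlan zeroWeights; split_ifs <;> simp
    · simp [permPlan, zeroWeights]

theorem containsPerfectMatching_permPlan {n : ℕ} (σ : Equiv.Perm (Fin n)) :
    ContainsPerfectMatching 0 (permPlan σ) := by
  refine ⟨permPlan σ, ⟨isPlan_permPlan σ, σ, ?_⟩, subset_rfl, fun i j => Or.inl rfl⟩
  ext q
  simp [planSupport, permPlan]

theorem planCost_permPlan_le {n : ℕ} {c : Fin n → Fin n → ℝ} {σ : Equiv.Perm (Fin n)} {B : ℝ}
    (h : ∀ i, c i (σ i) ≤ B) : planCost c (permPlan σ) ≤ B := by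
  refine iSup_le fun i => iSup_le fun j => ?_
  unfold permPlan
  split_ifs with hj
  · subst hj; simpa using h i
  · simp

theorem isOptimalPlan_permPlan {n : ℕ} {c : Fin n → Fin n → ℝ} {σ : Equiv.Perm (Fin n)} {B : ℝ}
    (hσ : ∀ i, c i (σ i) ≤ B)
    (hB : ∀ h, IsPlan (zeroWeights n) (zeroWeights n) h → (B : EReal) ≤ planCost c h) :
    IsOptimalPlan c (zeroWeights n) (zeroWeights n) (permPlan σ) := by
  refine ⟨isPlan_permPlan σ, le_antisymm ?_ (sInf_le ⟨_, isPlan_permPlan σ, rfl⟩)⟩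
  refine (planCost_permPlan_le hσ).trans (le_sInf ?_)
  rintro t ⟨h, hh, rfl⟩
  exact hB h hh

theorem le_planCost_of_eq_zero {ι κ : Type*} {c : ι → κ → ℝ} {h : ι → κ → EReal} {i : ι} {j : κ}
    {B : ℝ} (hij : h i j = 0) (hB : B ≤ c i j) : (B : EReal) ≤ planCost c h := by
  refine le_trans ?_ (le_iSup₂_of_le (f := fun i j => (c i j : EReal) + h i j) i j le_rfl)
  simpa [hij] using hB

/-- The row is finite, so its maximum 0 is attained, and the cost at that entry is paid in full. -/
theorem le_planCost_of_row {n : ℕ} {c : Fin n → Fin n → ℝ} {h : Fin n → Fin n → EReal}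
    (hh : IsPlan (zeroWeights n) (zeroWeights n) h) {B : ℝ} (i : Fin n) (hB : ∀ j, B ≤ c i j) :
    (B : EReal) ≤ planCost c h := by
  have : Nonempty (Fin n) := ⟨i⟩
  obtain ⟨j, hj⟩ := exists_eq_ciSup_of_finite (f := fun j => h i j)
  exact le_planCost_of_eq_zero (hj.trans (hh.row_max i)) (hB j)

theorem le_planCost_of_col {n : ℕ} {c : Fin n → Fin n → ℝ} {h : Fin n → Fin n → EReal}
    (hh : IsPlan (zeroWeights n) (zeroWeights n) h) {B : ℝ} (j : Fin n) (hB : ∀ i, B ≤ c i j) :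
    (B : EReal) ≤ planCost c h := by
  have : Nonempty (Fin n) := ⟨j⟩
  obtain ⟨i, hi⟩ := exists_eq_ciSup_of_finite (f := fun i => h i j)
  exact le_planCost_of_eq_zero (hi.trans (hh.col_max j)) (hB i)

/-- If the cost takes two values and no optimal plan contains a perfect matching, then the
positions of the smaller value meet all rows and columns but contain no perfect matching. -/
theorem exists_optimal_or {n : ℕ} (hn : 0 < n) {c : Fin n → Fin n → ℝ} {β₁ β₂ : ℝ} (hβ : β₁ < β₂)
    (hc : ∀ i j, c i j = β₁ ∨ c i j = β₂) :
    (∃ h, IsOptimalPlan c (zeroWeights n) (zeroWeights n) h ∧ ContainsPerfectMatching 0 h) ∨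
      ((∀ i, ∃ j, c i j = β₁) ∧ (∀ j, ∃ i, c i j = β₁) ∧
        ¬ ∃ σ : Equiv.Perm (Fin n), ∀ i, c i (σ i) = β₁) := by
  have hle : ∀ i j, c i j ≤ β₂ := fun i j => (hc i j).elim (fun h => h ▸ hβ.le) (fun h => h.le)
  have hge : ∀ i j, β₁ ≤ c i j := fun i j => (hc i j).elim (fun h => h.ge) (fun h => h ▸ hβ.le)
  have key : ∀ (σ : Equiv.Perm (Fin n)) (B : ℝ), (∀ i, c i (σ i) ≤ B) →
      (∀ h, IsPlan (zeroWeights n) (zeroWeights n) h → (B : EReal) ≤ planCost c h) →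
      ∃ h, IsOptimalPlan c (zeroWeights n) (zeroWeights n) h ∧ ContainsPerfectMatching 0 h :=
    fun σ B h₁ h₂ => ⟨_, isOptimalPlan_permPlan h₁ h₂, containsPerfectMatching_permPlan σ⟩
  by_cases hr : ∀ i, ∃ j, c i j = β₁
  · by_cases hl : ∀ j, ∃ i, c i j = β₁
    · by_cases hσ : ∃ σ : Equiv.Perm (Fin n), ∀ i, c i (σ i) = β₁
      · obtain ⟨σ, hσ⟩ := hσ
        exact Or.inl (key σ β₁ (fun i => (hσ i).le)
          fun h hh => le_planCost_of_row hh ⟨0, hn⟩ (hge _))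
      · exact Or.inr ⟨hr, hl, hσ⟩
    · push Not at hl
      obtain ⟨j, hj⟩ := hl
      -- All plans cost at least `β₂` here, so any permutation would do; the identity is taken.
      exact Or.inl (key 1 β₂ (fun i => hle _ _) fun h hh =>
        le_planCost_of_col hh j fun i => ((hc i j).resolve_left (hj i)).ge)
  · push Not at hr
    obtain ⟨i, hi⟩ := hr
    exact Or.inl (key 1 β₂ (fun i => hle _ _) fun h hh =>
      le_planCost_of_row hh i fun j => ((hc i j).resolve_left (hi j)).ge)

/-! ### Minimal violations of Hall's condition -/

/-- An obstruction to a perfect matching: rows `S` all of whose neighbours lie in `T`,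
where each element of `T` has at least two neighbours in `S`. -/
def IsHallObstruction {α : Type*} (r : α → α → Prop) (S T : Finset α) : Prop :=
  (∀ t ∈ T, ∃ a ∈ S, ∃ b ∈ S, a ≠ b ∧ r a t ∧ r b t) ∧ ∀ s ∈ S, ∀ t ∉ T, ¬ r s t

open Classical in
-- Every clause comes from minimality: removing a point of S must restore Hall's condition, and the
-- complement of the neighbourhood T, a violator on the other side, cannot be smaller than S.
theorem exists_isHallObstruction_of_minimal {α : Type*} [Fintype α] {r : α → α → Prop}
    (hr : ∀ i, ∃ j, r i j) {S : Finset α}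
    (hS : ({b | ∃ a ∈ S, r a b} : Finset α).card < S.card)
    (hmin : ∀ A : Finset α, A.card < S.card →
      A.card ≤ ({b | ∃ a ∈ A, r a b} : Finset α).card)
    (hmin' : ∀ A : Finset α, A.card < S.card →
      A.card ≤ ({b | ∃ a ∈ A, r b a} : Finset α).card) :
    ∃ m T, 1 ≤ m ∧ 2 * m + 1 ≤ Fintype.card α ∧ S.card = m + 1 ∧ T.card = m ∧
      IsHallObstruction r S T := by
  set T : Finset α := {b | ∃ a ∈ S, r a b} with hT
  have hmono : ∀ s, ({b | ∃ a ∈ S.erase s, r a b} : Finset α) ⊆ T := by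
    intro s b
    simp only [hT, Finset.mem_filter, Finset.mem_univ, true_and]
    rintro ⟨a, ha, hab⟩
    exact ⟨a, Finset.mem_of_mem_erase ha, hab⟩
  have hpos : 0 < S.card := by omega
  obtain ⟨s, hs⟩ := Finset.card_pos.1 hpos
  have hTc : S.card = T.card + 1 := by
    have h1 := hmin (S.erase s) (Finset.card_erase_lt_of_mem hs)
    have h2 := Finset.card_le_card (hmono s)
    rw [Finset.card_erase_of_mem hs] at h1
    omega
  refine ⟨T.card, T, ?_, ?_, hTc, rfl, ?_, ?_⟩
  · obtain ⟨t, ht⟩ := hr s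
    exact Finset.card_pos.2 ⟨t, by simpa [hT] using ⟨s, hs, ht⟩⟩
  · by_contra hlt
    have h1 := Finset.card_compl T
    have h2 := Finset.card_le_univ T
    have h4 := Finset.card_le_univ S
    -- If 2m + 1 exceeded the number of vertices, Tᶜ would be smaller than S. Its neighbours lie in
    -- Sᶜ, which has one element fewer than Tᶜ.
    have h3 := hmin' Tᶜ (by omega)
    have h5 : ({b | ∃ a ∈ Tᶜ, r b a} : Finset α) ⊆ Sᶜ := by
      intro b
      simp only [hT, Finset.mem_filter, Finset.mem_univ, true_and, Finset.mem_compl]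
      rintro ⟨a, ha, hab⟩ hb
      exact ha ⟨b, hb, hab⟩
    have h6 := Finset.card_le_card h5
    rw [Finset.card_compl] at h6
    omega
  · intro t ht
    have ht' := ht
    simp only [hT, Finset.mem_filter, Finset.mem_univ, true_and] at ht'
    obtain ⟨a, ha, hat⟩ := ht'
    by_contra hcon
    push Not at hcon
    -- If a were the only neighbour of t in S, removing a from S would remove t from the
    -- neighbourhood, leaving m rows with at most m - 1 neighbours.
    have h1 := hmin (S.erase a) (Finset.card_erase_lt_of_mem ha)
    have h2 : ({b | ∃ a' ∈ S.erase a, r a' b} : Finset α) ⊆ T.erase t := by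
      intro b hb
      refine Finset.mem_erase.2 ⟨?_, hmono a hb⟩
      rintro rfl
      simp only [Finset.mem_filter, Finset.mem_univ, true_and, Finset.mem_erase] at hb
      obtain ⟨a', ⟨hne, ha'⟩, hr'⟩ := hb
      exact hcon a ha a' ha' hne.symm hat hr'
    have h3 := Finset.card_le_card h2
    rw [Finset.card_erase_of_mem ht] at h3
    rw [Finset.card_erase_of_mem ha] at h1
    have := Finset.card_pos.2 ⟨t, ht⟩
    omega
  · intro s hs t ht hst
    exact ht (by simpa [hT] using ⟨s, hs, hst⟩)

open Classical in
theorem exists_isHallObstruction {α : Type*} [Fintype α] {r : α → α → Prop}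
    (hr : ∀ i, ∃ j, r i j) (hl : ∀ j, ∃ i, r i j)
    (hσ : ¬ ∃ σ : Equiv.Perm α, ∀ i, r i (σ i)) :
    ∃ m S T, 1 ≤ m ∧ 2 * m + 1 ≤ Fintype.card α ∧ S.card = m + 1 ∧ T.card = m ∧
      (IsHallObstruction r S T ∨ IsHallObstruction (fun i j => r j i) S T) := by
  -- Row and column violators are minimized jointly, so that the smallest one is minimal against
  -- both sides.
  have hex : ∃ k, ∃ S : Finset α, S.card = k ∧
      (({b | ∃ a ∈ S, r a b} : Finset α).card < S.card ∨
        ({b | ∃ a ∈ S, r b a} : Finset α).card < S.card) := by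
    by_contra hcon
    push Not at hcon
    obtain ⟨f, hf, hrf⟩ := (Fintype.all_card_le_filter_rel_iff_exists_injective r).1
      fun A => (hcon _ A rfl).1
    exact hσ ⟨Equiv.ofBijective f (Finite.injective_iff_bijective.1 hf), hrf⟩
  obtain ⟨S, hSk, hS⟩ := Nat.find_spec hex
  have hmin : ∀ A : Finset α, A.card < S.card →
      A.card ≤ ({b | ∃ a ∈ A, r a b} : Finset α).card ∧
      A.card ≤ ({b | ∃ a ∈ A, r b a} : Finset α).card := by
    intro A hA
    have := Nat.find_min hex (hSk ▸ hA)
    push Not at this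
    exact this A rfl
  rcases hS with hS | hS
  · obtain ⟨m, T, h1, h2, h3, h4, h5⟩ := exists_isHallObstruction_of_minimal hr hS
      (fun A hA => (hmin A hA).1) (fun A hA => (hmin A hA).2)
    exact ⟨m, S, T, h1, h2, h3, h4, Or.inl h5⟩
  · obtain ⟨m, T, h1, h2, h3, h4, h5⟩ := exists_isHallObstruction_of_minimal
      (r := fun i j => r j i) hl hS
      (fun A hA => (hmin A hA).2) (fun A hA => (hmin A hA).1)
    exact ⟨m, S, T, h1, h2, h3, h4, Or.inr h5⟩

/-! ### Probability of a fixed obstruction -/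

section Probability

variable {Ω : Type*} [MeasurableSpace Ω] {P : Measure Ω} {n : ℕ}
  {β₁ β₂ p : ℝ} {c : Ω → Fin n → Fin n → ℝ}

theorem IsBernoulliCostMatrix.transpose (hc : IsBernoulliCostMatrix P β₁ β₂ p c) :
    IsBernoulliCostMatrix P β₁ β₂ p fun ω i j => c ω j i where
  measurable_entry i j := hc.measurable_entry j i
  indep := hc.indep.precomp (g := Prod.swap) Prod.swap_injective
  prob_left i j := hc.prob_left j i
  prob_right i j := hc.prob_right j i

theorem IsBernoulliCostMatrix.measurableSet_eq (hc : IsBernoulliCostMatrix P β₁ β₂ p c)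
    (i j : Fin n) (b : ℝ) : MeasurableSet {ω | c ω i j = b} :=
  hc.measurable_entry i j (measurableSet_singleton b)

theorem IsBernoulliCostMatrix.prob_ne [IsProbabilityMeasure P]
    (hc : IsBernoulliCostMatrix P β₁ β₂ p c) (i j : Fin n) :
    P.real {ω | c ω i j ≠ β₁} = 1 - p := by
  rw [← hc.prob_left i j]
  exact probReal_compl_eq_one_sub (hc.measurableSet_eq i j β₁)

theorem IsBernoulliCostMatrix.ae_eq_or [IsProbabilityMeasure P]
    (hβ : β₁ < β₂) (hc : IsBernoulliCostMatrix P β₁ β₂ p c) :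
    ∀ᵐ ω ∂P, ∀ i j, c ω i j = β₁ ∨ c ω i j = β₂ := by
  refine ae_all_iff.2 fun i => ae_all_iff.2 fun j => ?_
  have h : P.real ({ω | c ω i j = β₁} ∪ {ω | c ω i j = β₂}) = 1 := by
    rw [measureReal_union _ (hc.measurableSet_eq i j β₂), hc.prob_left, hc.prob_right]
    · ring
    · refine Set.disjoint_left.2 fun ω h₁ h₂ => hβ.ne ?_
      exact Eq.trans (Eq.symm h₁) h₂
  have h' := probReal_compl_eq_one_sub (μ := P)
    ((hc.measurableSet_eq i j β₁).union (hc.measurableSet_eq i j β₂))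
  rw [h, sub_self] at h'
  exact (measureReal_eq_zero_iff).1 h'

theorem IsBernoulliCostMatrix.prob_forall_mem (hc : IsBernoulliCostMatrix P β₁ β₂ p c)
    {B : Fin n → Fin n → Set ℝ} (hB : ∀ i j, MeasurableSet (B i j)) :
    P.real {ω | ∀ i j, c ω i j ∈ B i j} = ∏ j, ∏ i, P.real {ω | c ω i j ∈ B i j} := by
  have h := hc.indep.measure_inter_preimage_eq_mul Finset.univ
    (sets := fun q => B q.1 q.2) fun q _ => hB q.1 q.2
  have h' : {ω | ∀ i j, c ω i j ∈ B i j} =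
      ⋂ q ∈ (Finset.univ : Finset (Fin n × Fin n)), (fun ω => c ω q.1 q.2) ⁻¹' B q.1 q.2 := by
    ext ω; simp
  rw [h', measureReal_def, h, ENNReal.toReal_prod, Fintype.prod_prod_type_right]
  rfl

/-- The probability that prescribed pairs of entries in the columns of `T` are equal to `β₁` and
that the entries in `S × Tᶜ` are not. -/
theorem IsBernoulliCostMatrix.prob_pairs [IsProbabilityMeasure P]
    (hc : IsBernoulliCostMatrix P β₁ β₂ p c)
    (S T : Finset (Fin n)) (g : Fin n → Fin n × Fin n) (hg : ∀ t ∈ T, (g t).1 ≠ (g t).2) :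
    P.real {ω | (∀ t ∈ T, c ω (g t).1 t = β₁ ∧ c ω (g t).2 t = β₁) ∧
      ∀ s ∈ S, ∀ t ∉ T, c ω s t ≠ β₁} = (p ^ 2) ^ T.card * ((1 - p) ^ S.card) ^ (n - T.card) := by
  classical
  -- The event is a product of one-entry constraints, so independence applies; the product is then
  -- evaluated column by column.
  set B : Fin n → Fin n → Set ℝ := fun i j =>
    if j ∈ T then (if i = (g j).1 ∨ i = (g j).2 then {β₁} else Set.univ)
    else (if i ∈ S then {β₁}ᶜ else Set.univ) with hB
  have hBm : ∀ i j, MeasurableSet (B i j) := by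
    intro i j
    simp only [hB]
    split_ifs <;> measurability
  have hset : {ω | (∀ t ∈ T, c ω (g t).1 t = β₁ ∧ c ω (g t).2 t = β₁) ∧
      ∀ s ∈ S, ∀ t ∉ T, c ω s t ≠ β₁} = {ω | ∀ i j, c ω i j ∈ B i j} := by
    ext ω
    simp only [Set.mem_ofPred_eq, hB]
    constructor
    · rintro ⟨h₁, h₂⟩ i j
      split_ifs with hj hi hi
      · rcases hi with rfl | rfl
        exacts [(h₁ j hj).1, (h₁ j hj).2]
      · trivial
      · exact h₂ i hi j hj
      · trivial
    · intro h
      refine ⟨fun t ht => ⟨?_, ?_⟩, fun s hs t ht => ?_⟩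
      · simpa [ht] using h (g t).1 t
      · simpa [ht] using h (g t).2 t
      · simpa [ht, hs] using h s t
  have hin : ∀ j ∈ T, ∏ i, P.real {ω | c ω i j ∈ B i j} = p ^ 2 := by
    intro j hj
    have : ∀ i, P.real {ω | c ω i j ∈ B i j} =
        if i ∈ ({(g j).1, (g j).2} : Finset (Fin n)) then p else 1 := by
      intro i
      simp only [hB, hj, if_true, Finset.mem_insert, Finset.mem_singleton]
      split_ifs
      · exact hc.prob_left i j
      · simp
    simp_rw [this]
    rw [Finset.prod_ite_mem, Finset.univ_inter, Finset.prod_const, Finset.card_pair (hg j hj)]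
  have hout : ∀ j ∈ Tᶜ, ∏ i, P.real {ω | c ω i j ∈ B i j} = (1 - p) ^ S.card := by
    intro j hj
    have : ∀ i, P.real {ω | c ω i j ∈ B i j} = if i ∈ S then 1 - p else 1 := by
      intro i
      simp only [hB, Finset.mem_compl.1 hj, if_false]
      split_ifs
      · exact hc.prob_ne i j
      · simp
    simp_rw [this]
    rw [Finset.prod_ite_mem, Finset.univ_inter, Finset.prod_const]
  rw [hset, hc.prob_forall_mem hBm, ← Finset.prod_mul_prod_compl T, Finset.prod_congr rfl hin,
    Finset.prod_congr rfl hout, Finset.prod_const, Finset.prod_const, Finset.card_compl,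
    Fintype.card_fin]

theorem IsBernoulliCostMatrix.prob_isHallObstruction_le [IsProbabilityMeasure P]
    (hc : IsBernoulliCostMatrix P β₁ β₂ p c)
    (hp : p ≤ 1) (S T : Finset (Fin n)) :
    P.real {ω | IsHallObstruction (fun i j => c ω i j = β₁) S T} ≤
      (S.card ^ 2 : ℝ) ^ T.card * ((p ^ 2) ^ T.card * ((1 - p) ^ S.card) ^ (n - T.card)) := by
  classical
  -- Choices of two distinct neighbours in S for each t in T. The single dummy value outside T keeps
  -- the count at most |S|^(2|T|).
  set F : Finset (Fin n → Fin n × Fin n) :=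
    Fintype.piFinset fun t => if t ∈ T then S.offDiag else {(t, t)} with hF
  have hFc : F.card ≤ (S.card ^ 2) ^ T.card := by
    rw [hF, Fintype.card_piFinset, ← Finset.prod_mul_prod_compl T,
      Finset.prod_congr (g := fun _ => S.offDiag.card) rfl (fun t ht => by simp [ht]),
      Finset.prod_congr (s₁ := Tᶜ) (g := fun _ => 1) rfl
        (fun t ht => by simp [Finset.mem_compl.1 ht])]
    simp only [Finset.prod_const, one_pow, mul_one]
    refine Nat.pow_le_pow_left ?_ _
    rw [Finset.offDiag_card, sq]
    exact Nat.sub_le _ _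
  have hsub : {ω | IsHallObstruction (fun i j => c ω i j = β₁) S T} ⊆
      ⋃ g ∈ F, {ω | (∀ t ∈ T, c ω (g t).1 t = β₁ ∧ c ω (g t).2 t = β₁) ∧
        ∀ s ∈ S, ∀ t ∉ T, c ω s t ≠ β₁} := by
    rintro ω ⟨h₁, h₂⟩
    choose! a ha b hb hab hra hrb using h₁
    refine Set.mem_iUnion₂.2 ⟨fun t => if t ∈ T then (a t, b t) else (t, t), ?_, ?_, h₂⟩
    · refine Fintype.mem_piFinset.2 fun t => ?_
      split_ifs with ht
      · exact Finset.mem_offDiag.2 ⟨ha t ht, hb t ht, hab t ht⟩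
      · simp
    · intro t ht
      simp only [ht, if_true]
      exact ⟨hra t ht, hrb t ht⟩
  refine (measureReal_mono hsub (measure_ne_top _ _)).trans ((measureReal_biUnion_finset_le _ _).trans ?_)
  rw [Finset.sum_congr rfl fun g hg => hc.prob_pairs S T g fun t ht => ?_, Finset.sum_const,
    nsmul_eq_mul]
  · have : 0 ≤ 1 - p := by linarith
    gcongr
    exact_mod_cast hFc
  · have := Fintype.mem_piFinset.1 hg t
    rw [if_pos ht] at this
    exact (Finset.mem_offDiag.1 this).2.2

end Probability

/-! ### First-moment estimate -/

/-- The expected number of Hall obstructions `(S, T)` with `|T| = m` is geometrically small. -/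
theorem choose_mul_choose_mul_le {n m : ℕ} {p : ℝ} (hn : 0 < n) (hm : 1 ≤ m) (hmn : 2 * m + 1 ≤ n)
    (hp₀ : 0 ≤ p) (hp₁ : p ≤ 1) (hp : Real.log n / n ≤ p) :
    (n.choose (m + 1) * n.choose m : ℝ) * (((m + 1 : ℕ) ^ 2 : ℝ) ^ m *
      ((p ^ 2) ^ m * ((1 - p) ^ (m + 1)) ^ (n - m))) ≤
      Real.exp 2 * (Real.exp 2 * ((n * p) ^ 2 * Real.exp (-(n * p / 4)))) ^ m := by
  have hn' : (0 : ℝ) < n := by exact_mod_cast hn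
  set x : ℝ := n * p with hx
  have hx0 : 0 ≤ x := by positivity
  have hlog : Real.log n ≤ x := by
    rw [div_le_iff₀ hn'] at hp; linarith
  set k : ℝ := ((m + 1 : ℕ) : ℝ) with hk
  have hk1 : 1 ≤ k := by simp [hk]
  have h1 : k ^ (m + 1) / (m + 1).factorial ≤ Real.exp k :=
    Real.pow_div_factorial_le_exp k (by positivity) _
  have h2 : k ^ m / m.factorial ≤ Real.exp k :=
    Real.pow_div_factorial_le_exp k (by positivity) _
  have hc1 := Nat.choose_le_pow_div (α := ℝ) (m + 1) n
  have hc2 := Nat.choose_le_pow_div (α := ℝ) m n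
  -- The factorials of the binomials absorb the k^(2m) choices of pairs, through kʲ/j! ≤ eᵏ.
  have h3 : (n.choose (m + 1) * n.choose m : ℝ) * (k ^ 2) ^ m ≤
      n ^ (2 * m + 1) * Real.exp (2 * k) := by
    calc (n.choose (m + 1) * n.choose m : ℝ) * (k ^ 2) ^ m
        ≤ (n ^ (m + 1) / (m + 1).factorial * (n ^ m / m.factorial)) * (k ^ (m + 1) * k ^ m) := by
          rw [← pow_mul, ← pow_add]
          gcongr
          · omega
      _ = n ^ (2 * m + 1) *
          ((k ^ (m + 1) / (m + 1).factorial) * (k ^ m / m.factorial)) := by ring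
      _ ≤ n ^ (2 * m + 1) * (Real.exp k * Real.exp k) := by gcongr
      _ = _ := by rw [← Real.exp_add]; ring_nf
  -- The exponent is split so that 1 pays for a spare factor n and m/4 gives decay in m. It suffices
  -- that m(3n/4 - m - 1) ≥ 0, which follows from n ≥ 2m + 1 and m ≥ 1.
  have h4 : (1 - p) ^ ((m + 1) * (n - m)) ≤ Real.exp (-(x * (1 + m / 4))) := by
    calc (1 - p) ^ ((m + 1) * (n - m)) ≤ Real.exp (-p) ^ ((m + 1) * (n - m)) :=
          pow_le_pow_left₀ (by linarith) (Real.one_sub_le_exp_neg p) _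
      _ = Real.exp (-(p * ((m + 1) * (n - m)))) := by
          rw [← Real.exp_nat_mul]
          push_cast [Nat.cast_sub (show m ≤ n by omega)]
          ring_nf
      _ ≤ _ := by
          refine Real.exp_le_exp.2 (neg_le_neg ?_)
          have ha : (2 * m + 1 : ℝ) ≤ n := by exact_mod_cast hmn
          have hb : (1 : ℝ) ≤ m := by exact_mod_cast hm
          have : n * (1 + m / 4 : ℝ) ≤ (m + 1) * (n - m) := by nlinarith
          calc x * (1 + m / 4) = p * (n * (1 + m / 4)) := by rw [hx]; ring
            _ ≤ _ := by gcongr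
  -- The threshold p ≥ (log n)/n is exactly what cancels the spare n in n^(2m+1) p^(2m) = n x^(2m).
  have h5 : n * Real.exp (-x) ≤ 1 := by
    rw [Real.exp_neg, ← div_eq_mul_inv, div_le_one (Real.exp_pos _)]
    exact (Real.log_le_iff_le_exp hn').1 hlog
  calc _ = ((n.choose (m + 1) * n.choose m : ℝ) * (k ^ 2) ^ m) *
        (p ^ 2) ^ m * (1 - p) ^ ((m + 1) * (n - m)) := by rw [pow_mul]; ring
    _ ≤ (n ^ (2 * m + 1) * Real.exp (2 * k)) * (p ^ 2) ^ m *
        Real.exp (-(x * (1 + m / 4))) := by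
      have : 0 ≤ 1 - p := by linarith
      gcongr
    _ = (n * Real.exp (-x)) *
        (Real.exp 2 * (Real.exp 2 * (x ^ 2 * Real.exp (-(x / 4)))) ^ m) := by
      have e1 : Real.exp (2 * k) = Real.exp 2 * Real.exp 2 ^ m := by
        rw [← Real.exp_nat_mul, ← Real.exp_add, hk]; push_cast; ring_nf
      have e2 : Real.exp (-(x * (1 + m / 4))) = Real.exp (-x) * Real.exp (-(x / 4)) ^ m := by
        rw [← Real.exp_nat_mul, ← Real.exp_add]; ring_nf
      rw [e1, e2, mul_pow, mul_pow, hx]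
      ring
    _ ≤ 1 * (Real.exp 2 * (Real.exp 2 * (x ^ 2 * Real.exp (-(x / 4)))) ^ m) := by gcongr
    _ = _ := one_mul _

theorem sum_Icc_pow_le {q : ℝ} (hq₀ : 0 ≤ q) (hq₁ : q < 1) (n : ℕ) :
    ∑ m ∈ Finset.Icc 1 n, q ^ m ≤ q * (1 - q)⁻¹ := by
  rw [← tsum_geometric_of_lt_one hq₀ hq₁, ← tsum_mul_left, ← Finset.Ico_add_one_right_eq_Icc,
    Finset.sum_Ico_eq_sum_range]
  have hs : Summable fun i => q * q ^ i := (summable_geometric_of_lt_one hq₀ hq₁).mul_left q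
  refine le_trans (le_of_eq ?_) (hs.sum_le_tsum (Finset.range n) fun i _ => by positivity)
  exact Finset.sum_congr (by simp) fun i _ => by ring

/-! ### Union bound and passage to the limit -/

section Probability

variable {Ω : Type*} [MeasurableSpace Ω] {P : Measure Ω} {n : ℕ}
  {β₁ β₂ p : ℝ} {c : Ω → Fin n → Fin n → ℝ}

theorem IsBernoulliCostMatrix.prob_exists_isHallObstruction_le [IsProbabilityMeasure P]
    (hc : IsBernoulliCostMatrix P β₁ β₂ p c) (hn : 0 < n) (hp : Real.log n / n ≤ p) {q : ℝ}
    (hq : q = Real.exp 2 * ((n * p) ^ 2 * Real.exp (-(n * p / 4)))) (hq₁ : q < 1) :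
    P.real {ω | ∃ m S T, 1 ≤ m ∧ 2 * m + 1 ≤ n ∧ S.card = m + 1 ∧ T.card = m ∧
      IsHallObstruction (fun i j => c ω i j = β₁) S T} ≤ Real.exp 2 * (q * (1 - q)⁻¹) := by
  classical
  have hp₀ : 0 ≤ p := hc.prob_left ⟨0, hn⟩ ⟨0, hn⟩ ▸ measureReal_nonneg
  have hp₁ : p ≤ 1 := hc.prob_left ⟨0, hn⟩ ⟨0, hn⟩ ▸ measureReal_le_one
  have hq₀ : 0 ≤ q := by rw [hq]; positivity
  have hsub : {ω | ∃ m S T, 1 ≤ m ∧ 2 * m + 1 ≤ n ∧ S.card = m + 1 ∧ T.card = m ∧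
      IsHallObstruction (fun i j => c ω i j = β₁) S T} ⊆
      ⋃ m ∈ (Finset.Icc 1 n).filter (fun m => 2 * m + 1 ≤ n),
        ⋃ ST ∈ (Finset.univ : Finset (Fin n)).powersetCard (m + 1) ×ˢ
          (Finset.univ : Finset (Fin n)).powersetCard m,
          {ω | IsHallObstruction (fun i j => c ω i j = β₁) ST.1 ST.2} := by
    rintro ω ⟨m, S, T, h1, h2, h3, h4, h5⟩
    refine Set.mem_iUnion₂.2 ⟨m, ?_, Set.mem_iUnion₂.2 ⟨(S, T), ?_, h5⟩⟩
    · simp only [Finset.mem_filter, Finset.mem_Icc]; omega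
    · simp [Finset.mem_powersetCard, h3, h4]
  refine (measureReal_mono hsub (measure_ne_top _ _)).trans ((measureReal_biUnion_finset_le _ _).trans ?_)
  calc _ ≤ ∑ m ∈ (Finset.Icc 1 n).filter (fun m => 2 * m + 1 ≤ n), Real.exp 2 * q ^ m := by
        refine Finset.sum_le_sum fun m hm => ?_
        simp only [Finset.mem_filter, Finset.mem_Icc] at hm
        have hST : ∀ ST ∈ (Finset.univ : Finset (Fin n)).powersetCard (m + 1) ×ˢ
            (Finset.univ : Finset (Fin n)).powersetCard m,
            P.real {ω | IsHallObstruction (fun i j => c ω i j = β₁) ST.1 ST.2} ≤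
              ((m + 1 : ℕ) ^ 2 : ℝ) ^ m * ((p ^ 2) ^ m * ((1 - p) ^ (m + 1)) ^ (n - m)) := by
          intro ST hST
          rw [Finset.mem_product, Finset.mem_powersetCard, Finset.mem_powersetCard] at hST
          have := hc.prob_isHallObstruction_le hp₁ ST.1 ST.2
          rwa [hST.1.2, hST.2.2] at this
        refine (measureReal_biUnion_finset_le _ _).trans
          ((Finset.sum_le_card_nsmul _ _ _ hST).trans ?_)
        rw [hq, nsmul_eq_mul, Finset.card_product, Finset.card_powersetCard,
          Finset.card_powersetCard, Finset.card_univ, Fintype.card_fin, Nat.cast_mul]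
        exact choose_mul_choose_mul_le hn hm.1.1 hm.2 hp₀ hp₁ hp
    _ ≤ ∑ m ∈ Finset.Icc 1 n, Real.exp 2 * q ^ m :=
        Finset.sum_le_sum_of_subset_of_nonneg (Finset.filter_subset _ _)
          fun _ _ _ => by positivity
    _ ≤ _ := by
        rw [← Finset.mul_sum]
        gcongr
        exact sum_Icc_pow_le hq₀ hq₁ n

theorem IsBernoulliCostMatrix.one_sub_le_prob_exists_optimal [IsProbabilityMeasure P]
    (hc : IsBernoulliCostMatrix P β₁ β₂ p c) (hβ : β₁ < β₂) (hn : 0 < n)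
    (hp : Real.log n / n ≤ p) {q : ℝ}
    (hq : q = Real.exp 2 * ((n * p) ^ 2 * Real.exp (-(n * p / 4)))) (hq₁ : q < 1) :
    1 - 2 * (Real.exp 2 * (q * (1 - q)⁻¹)) ≤
      P.real {ω | ∃ h, IsOptimalPlan (c ω) (zeroWeights n) (zeroWeights n) h ∧
        ContainsPerfectMatching 0 h} := by
  set A := {ω | ∃ h, IsOptimalPlan (c ω) (zeroWeights n) (zeroWeights n) h ∧
    ContainsPerfectMatching 0 h}
  set E₁ := {ω | ∃ m S T, 1 ≤ m ∧ 2 * m + 1 ≤ n ∧ S.card = m + 1 ∧ T.card = m ∧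
    IsHallObstruction (fun i j => c ω i j = β₁) S T}
  set E₂ := {ω | ∃ m S T, 1 ≤ m ∧ 2 * m + 1 ≤ n ∧ S.card = m + 1 ∧ T.card = m ∧
    IsHallObstruction (fun i j => c ω j i = β₁) S T}
  have h₁ : P.real E₁ ≤ _ := hc.prob_exists_isHallObstruction_le hn hp hq hq₁
  have h₂ : P.real E₂ ≤ _ := hc.transpose.prob_exists_isHallObstruction_le hn hp hq hq₁
  -- Covering almost all of Ω and subadditivity suffice, so measurability of the three events is not
  -- needed.
  have hcov : P.real (A ∪ (E₁ ∪ E₂)) = 1 := by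
    have : (A ∪ (E₁ ∪ E₂) : Set Ω) =ᵐ[P] Set.univ := by
      refine eventuallyEq_univ.2 ?_
      filter_upwards [hc.ae_eq_or hβ] with ω hω
      rcases exists_optimal_or hn hβ hω with h | ⟨hr, hl, hσ⟩
      · exact Or.inl h
      · obtain ⟨m, S, T, h1, h2, h3, h4, h5 | h5⟩ :=
          exists_isHallObstruction (r := fun i j => c ω i j = β₁) hr hl hσ
        · exact Or.inr (Or.inl ⟨m, S, T, h1, by simpa using h2, h3, h4, h5⟩)
        · exact Or.inr (Or.inr ⟨m, S, T, h1, by simpa using h2, h3, h4, h5⟩)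
    rw [measureReal_congr this, probReal_univ]
  have h₃ := measureReal_union_le (μ := P) A (E₁ ∪ E₂)
  have h₄ := measureReal_union_le (μ := P) E₁ E₂
  linarith

end Probability

theorem tendsto_sq_mul_exp_neg_div_four :
    Tendsto (fun x : ℝ => Real.exp 2 * (x ^ 2 * Real.exp (-(x / 4)))) atTop (𝓝 0) := by
  have h := ((Real.tendsto_pow_mul_exp_neg_atTop_nhds_zero 2).comp
    (tendsto_id.atTop_div_const (show (0 : ℝ) < 4 by norm_num))).const_mul (Real.exp 2 * 16)
  rw [mul_zero] at h
  refine h.congr fun x => ?_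
  simp only [Function.comp, id]
  ring

end TropicalTransport

theorem mainTheorem3 {Ω : ℕ → Type*} [∀ n, MeasurableSpace (Ω n)]
    (P : ∀ n, Measure (Ω n)) [∀ n, IsProbabilityMeasure (P n)]
    (β₁ β₂ : ℝ) (hβ : β₁ < β₂) (p : ℕ → ℝ)
    (c : ∀ n, Ω n → Fin n → Fin n → ℝ)
    (hc : ∀ n, TropicalTransport.IsBernoulliCostMatrix (P n) β₁ β₂ (p n) (c n))
    (hp : ∀ᶠ n : ℕ in atTop, Real.log n / n ≤ p n) :
    Tendsto
      (fun n : ℕ => (P n).real {ω | ∃ h : Fin n → Fin n → EReal,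
        TropicalTransport.IsOptimalPlan (c n ω)
          (TropicalTransport.zeroWeights n) (TropicalTransport.zeroWeights n) h ∧
        TropicalTransport.ContainsPerfectMatching 0 h})
      atTop (𝓝 1) := by
  have hx : Tendsto (fun n : ℕ => (n : ℝ) * p n) atTop atTop := by
    refine tendsto_atTop_mono' _ ?_ (Real.tendsto_log_atTop.comp tendsto_natCast_atTop_atTop)
    filter_upwards [hp, eventually_gt_atTop 0] with n hn h0
    rw [div_le_iff₀ (by exact_mod_cast h0)] at hn
    rw [mul_comm]
    exact hn
  have hq := TropicalTransport.tendsto_sq_mul_exp_neg_div_four.comp hx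
  -- The lower bound 1 - 2e² q/(1 - q), the 2 counting row and column obstructions, tends to 1 as q
  -- → 0.
  have hlow := ((hq.mul ((hq.const_sub 1).inv₀ (by norm_num))).const_mul
    (Real.exp 2)).const_mul 2 |>.const_sub 1
  simp only [zero_mul, mul_zero, sub_zero] at hlow
  refine tendsto_of_tendsto_of_tendsto_of_le_of_le' hlow tendsto_const_nhds ?_
    (Eventually.of_forall fun n => measureReal_le_one)
  filter_upwards [hp, eventually_gt_atTop 0, hq.eventually_lt_const one_pos] with n hn h0 hq1
  exact (hc n).one_sub_le_prob_exists_optimal hβ h0 hn rfl hq1
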